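/- For real $k$ with $|k|<1$ let $$\mathbf K(k)=\int_0^{\pi/2}\frac{d\theta}{\sqrt{1-k^2\sin^2\theta}}$$ be the complete elliptic integral of the first kind with modulus $k$, and let $\Gamma(s)=\int_0^\infty t^{s-1}e^{-t}\,dt$ $(s>0)$ be Euler's gamma function. Then the integrand below, which is defined for all $x\in[0,1]$ except $x=\tfrac12$, is integrable on $[0,1]$, and $$\int_0^1\frac{\mathbf K\bigl(2\sqrt{x(1-x)}\bigr)}{\sqrt{\frac98+\frac{1-2x}{\sqrt2}}}\,dx=\frac{\Gamma\left(\frac14\right)^4}{16\sqrt2\,\pi}.$$ -/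

import Mathlib

/-- The complete elliptic integral of the first kind with (real) modulus `k`,
`K(k) = ∫_0^{π/2} dθ / √(1 - k² sin² θ)`, for `-1 < k < 1`. -/
noncomputable def ellipticK (k : ℝ) : ℝ :=
  ∫ θ in (0 : ℝ)..(Real.pi / 2), 1 / Real.sqrt (1 - k ^ 2 * Real.sin θ ^ 2)

/-! With `u = 1 - 2x` the integral is half of `∫ F u * K(√(1 - u²))` over `(-1, 1)`, where `F u = 1
/ √(9/8 + u/√2)`. Up to a constant, `K(√(1 - u²))` is the density of `cos φ cos ψ` for independent
uniform angles (`integral_ellipticK_mul`), so the task is to evaluate a double integral of `F (cos φ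
cos ψ)`.

Expanding by the binomial series turns this into a double series, which a Saalschütz sum
(`sum_balancedTerm`) collapses to `π² ∑ (-1/8)^n w_n³` with `w_n = wallisRatio n`. The double
integral of `1 / √(1 + cos² x sin² y / 8)` has the same series (`integral_ring_eq`).

By Landen's transformation the second integral is, up to a constant, the average over rotations `k`
of `Φ(g k g)`, where `Φ(g) = ∫ |g v|⁻¹ dv` over unit vectors and `g` is a fixed diagonal matrix of
determinant 1. Rotation invariance makes that average `Φ(g)²`, a multiple of the squared lemniscate
period (`integral_integral_eq_lemniscatePeriod_sq`). A beta integral and the reflection formula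
express the period by `Γ(1/4)`. -/

open MeasureTheory

/-! ### A terminating balanced hypergeometric sum. -/

section Series

open Finset

/-- The central binomial ratio `(2n choose n) / 4 ^ n`, as a Wallis product. -/
noncomputable def wallisRatio (n : ℕ) : ℝ := ∏ i ∈ range n, (2 * (i : ℝ) + 1) / (2 * i + 2)

lemma wallisRatio_zero : wallisRatio 0 = 1 := by simp [wallisRatio]

lemma wallisRatio_succ (n : ℕ) :
    wallisRatio (n + 1) = (2 * (n : ℝ) + 1) / (2 * n + 2) * wallisRatio n := by
  rw [wallisRatio, prod_range_succ, mul_comm, wallisRatio]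

lemma wallisRatio_pos (n : ℕ) : 0 < wallisRatio n :=
  prod_pos fun _ _ => by positivity

lemma wallisRatio_le_one (n : ℕ) : wallisRatio n ≤ 1 :=
  prod_le_one (fun _ _ => by positivity) fun i _ => by
    rw [div_le_one (by positivity)]; linarith

/-- Summand of a terminating balanced `₃F₂` series. -/
noncomputable def balancedTerm (n j : ℕ) : ℝ :=
  (-1) ^ j * wallisRatio (n + j) * ((n + j).choose (2 * j)) * 4 ^ j * wallisRatio j ^ 2

/-- The Wilf–Zeilberger companion of `balancedTerm`. -/
noncomputable def balancedCompanion (n : ℕ) : ℕ → ℝ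
  | 0 => 0
  | j + 1 => -2 * (4 * n + 3) * (j + 1) ^ 2 * ((n + j + 1).choose (2 * j + 1)) *
      ((-1) ^ (j + 1) * wallisRatio (n + j + 1) * 4 ^ (j + 1) * wallisRatio (j + 1) ^ 2)

/-- The Wilf–Zeilberger identity: summed over `j` the right side telescopes, leaving a first-order
recurrence in `n`. The companion uses the binomial with lower index `2j + 1`: passing to `2j + 2`
brings in a factor `n - j`, which a rational certificate would have to divide by. -/
lemma balancedTerm_succ_sub (n j : ℕ) (hj : j ≤ n + 1) :
    8 * ((n : ℝ) + 1) ^ 3 * balancedTerm (n + 1) j - (2 * n + 1) ^ 3 * balancedTerm n j =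
      balancedCompanion n (j + 1) - balancedCompanion n j := by
  have h1 : ((n + j + 1).choose (2 * j + 1) : ℝ) * (2 * j + 1) =
      (n + j + 1) * (n + j).choose (2 * j) := by
    have := Nat.add_one_mul_choose_eq (n + j) (2 * j)
    exact_mod_cast this.symm
  have hw : wallisRatio (n + 1 + j) = (2 * (n + j) + 1) / (2 * (n + j) + 2) *
      wallisRatio (n + j) := by
    rw [show n + 1 + j = n + j + 1 by ring, wallisRatio_succ]; push_cast; ring
  have hw' : wallisRatio (n + j + 1) = (2 * (n + j) + 1) / (2 * (n + j) + 2) *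
      wallisRatio (n + j) := by
    rw [wallisRatio_succ]; push_cast; ring
  have h1' : ((n + j + 1).choose (2 * j + 1) : ℝ) =
      (n + j + 1) * (n + j).choose (2 * j) / (2 * j + 1) := by
    field_simp; linarith
  rcases j with _ | j
  · simp only [balancedTerm, balancedCompanion, hw, h1', wallisRatio_succ 0, wallisRatio_zero]
    simp
    field_simp
    ring
  · have h2 : ((n + 1 + (j + 1)).choose (2 * (j + 1)) : ℝ) =
        (n + (j + 1)).choose (2 * (j + 1)) + (n + j + 1).choose (2 * j + 1) := by
      rw [show n + 1 + (j + 1) = (n + j + 1) + 1 by ring,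
        show 2 * (j + 1) = (2 * j + 1) + 1 by ring, Nat.choose_succ_succ,
        show n + (j + 1) = n + j + 1 by ring]
      push_cast; ring
    have h3 : ((n + (j + 1)).choose (2 * (j + 1)) : ℝ) =
        (n - j) * (n + j + 1).choose (2 * j + 1) / (2 * j + 2) := by
      have := Nat.choose_succ_right_eq (n + j + 1) (2 * j + 1)
      -- The bound `hj` enters here: it keeps the natural subtraction `n - j` from truncating.
      have h4 : ((n + j + 1 - (2 * j + 1) : ℕ) : ℝ) = n - j := by
        rw [show n + j + 1 - (2 * j + 1) = n - j by omega, Nat.cast_sub (by omega)]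
      have h5 : ((n + j + 1).choose (2 * j + 1 + 1) : ℝ) * (2 * j + 1 + 1) =
          (n + j + 1).choose (2 * j + 1) * (n - j) := by
        rw [← h4]; exact_mod_cast this
      rw [show n + (j + 1) = n + j + 1 by ring, show 2 * (j + 1) = 2 * j + 1 + 1 by ring]
      field_simp; linarith
    have hv : wallisRatio (j + 1 + 1) = (2 * (j + 1) + 1) / (2 * (j + 1) + 2) *
        wallisRatio (j + 1) := by
      rw [wallisRatio_succ]; push_cast; ring
    simp only [balancedTerm, balancedCompanion, hw, hw', hv]
    rw [h1', h2, h3, show n + (j + 1) = n + j + 1 by ring]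
    generalize wallisRatio (j + 1) = u
    generalize wallisRatio (n + j + 1) = v
    generalize ((n + j + 1).choose (2 * j + 1) : ℝ) = w
    push_cast
    have : (2 * ((n : ℝ) + (j + 1)) + 2) ≠ 0 := by positivity
    have : (2 * ((j : ℝ) + 1) + 2) ≠ 0 := by positivity
    have : (2 * ((j : ℝ) + 1) + 1) ≠ 0 := by positivity
    field_simp
    ring

/-- A terminating case of the Pfaff–Saalschütz summation. -/
theorem sum_balancedTerm (n : ℕ) :
    ∑ j ∈ range (n + 1), balancedTerm n j = wallisRatio n ^ 3 := by
  induction n with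
  | zero => simp [balancedTerm, wallisRatio_zero]
  | succ n ih =>
    have h := sum_congr rfl fun j (hj : j ∈ range (n + 1 + 1)) =>
      balancedTerm_succ_sub n j (by rw [mem_range] at hj; omega)
    rw [sum_range_sub, sum_sub_distrib, ← mul_sum, ← mul_sum,
      sum_range_succ (balancedTerm n), ih] at h
    -- The range suited to `n + 1` is one longer than that for `n`; the extra term and the upper end
    -- of the telescoped sum vanish with their binomials.
    have h0 : balancedTerm n (n + 1) = 0 := by
      simp [balancedTerm, Nat.choose_eq_zero_of_lt (show n + (n + 1) < 2 * (n + 1) by omega)]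
    have h1 : balancedCompanion n (n + 1 + 1) = 0 := by
      simp [balancedCompanion,
        Nat.choose_eq_zero_of_lt (show n + (n + 1) + 1 < 2 * (n + 1) + 1 by omega)]
    rw [h0, h1, balancedCompanion] at h
    rw [wallisRatio_succ]
    have h8 : (8 * ((n : ℝ) + 1) ^ 3) ≠ 0 := by positivity
    apply mul_left_cancel₀ h8
    have : 8 * ((n : ℝ) + 1) ^ 3 * ((2 * (n : ℝ) + 1) / (2 * n + 2) * wallisRatio n) ^ 3 =
      (2 * n + 1) ^ 3 * wallisRatio n ^ 3 := by
      field_simp; ring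
    rw [this]; linarith

/-! ### Binomial series and moments of the cosine. -/

/-- The binomial series of `1 / √(1 + x)`. -/
theorem hasSum_one_div_sqrt_one_add {x : ℝ} (hx : |x| < 1) :
    HasSum (fun m => (-1) ^ m * wallisRatio m * x ^ m) (1 / √(1 + x)) := by
  have key : ∀ m : ℕ, Ring.choose (-1 / 2 : ℝ) m = (-1) ^ m * wallisRatio m := by
    intro m
    induction m with
    | zero => simp [wallisRatio_zero]
    | succ m ih =>
      -- This is the recurrence `(m + 1) C(a, m + 1) = C(a, m) (a - m)` at `a = -1/2`.
      have h := Ring.choose_smul_choose (-1 / 2 : ℝ) (Nat.le_succ m)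
      rw [Nat.succ_eq_add_one, Nat.add_sub_cancel_left, Ring.choose_one_right, ih,
        Nat.choose_succ_self_right, nsmul_eq_mul] at h
      rw [wallisRatio_succ]
      have h0 : ((m : ℝ) + 1) ≠ 0 := by positivity
      apply mul_left_cancel₀ h0
      push_cast at h
      rw [h]
      field_simp
      ring
  have h := (Real.one_add_rpow_hasFPowerSeriesOnBall_zero (a := -1 / 2)).hasSum (y := x)
    (by simpa [enorm_eq_nnnorm, ← NNReal.coe_lt_coe] using hx)
  have h1 : 0 ≤ 1 + x := by linarith [(abs_lt.1 hx).1]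
  simp only [binomialSeries_apply, key, zero_add, smul_eq_mul, List.ofFn_const,
    List.prod_replicate] at h
  rwa [neg_div, Real.rpow_neg h1, ← Real.sqrt_eq_rpow, ← one_div] at h

/-- The moments of `cos` with respect to the uniform probability measure on `[0, π]`. -/
noncomputable def cosMoment : ℕ → ℝ
  | 0 => 1
  | 1 => 0
  | k + 2 => ((k : ℝ) + 1) / (k + 2) * cosMoment k

lemma cosMoment_two_mul (j : ℕ) : cosMoment (2 * j) = wallisRatio j := by
  induction j with
  | zero => simp [cosMoment, wallisRatio_zero]
  | succ j ih =>
    rw [show 2 * (j + 1) = 2 * j + 2 by ring, cosMoment, ih, wallisRatio_succ]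
    push_cast; ring

lemma cosMoment_two_mul_add_one (j : ℕ) : cosMoment (2 * j + 1) = 0 := by
  induction j with
  | zero => simp [cosMoment]
  | succ j ih => rw [show 2 * (j + 1) + 1 = 2 * j + 1 + 2 by ring, cosMoment, ih, mul_zero]

lemma abs_cosMoment_le_one (k : ℕ) : |cosMoment k| ≤ 1 := by
  rcases Nat.even_or_odd' k with ⟨j, rfl | rfl⟩
  · rw [cosMoment_two_mul, abs_of_pos (wallisRatio_pos j)]; exact wallisRatio_le_one j
  · simp [cosMoment_two_mul_add_one]

lemma integral_cos_pow_eq_cosMoment : ∀ k : ℕ,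
    ∫ x in (0 : ℝ)..Real.pi, Real.cos x ^ k = Real.pi * cosMoment k
  | 0 => by simp [cosMoment]
  | 1 => by simp [cosMoment]
  | k + 2 => by
    rw [integral_cos_pow, integral_cos_pow_eq_cosMoment k, cosMoment]
    simp; ring

/-- Lebesgue measure on the square `(0, π] × (0, π]`. -/
noncomputable def squareMeasure : Measure (ℝ × ℝ) :=
  (volume.restrict (Set.Ioc 0 Real.pi)).prod (volume.restrict (Set.Ioc 0 Real.pi))

instance : IsFiniteMeasure squareMeasure := by unfold squareMeasure; infer_instance

lemma Continuous.integrable_squareMeasure {f : ℝ × ℝ → ℝ} (hf : Continuous f) :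
    Integrable f squareMeasure := by
  rw [squareMeasure, Measure.prod_restrict]
  exact (hf.continuousOn.integrableOn_compact (isCompact_Icc.prod isCompact_Icc)).mono_set
    (Set.prod_mono Set.Ioc_subset_Icc_self Set.Ioc_subset_Icc_self)

lemma integral_squareMeasure {f : ℝ × ℝ → ℝ} (hf : Continuous f) :
    ∫ z, f z ∂squareMeasure = ∫ x in (0 : ℝ)..Real.pi, ∫ y in (0 : ℝ)..Real.pi, f (x, y) := by
  have := hf.integrable_squareMeasure
  rw [squareMeasure] at this ⊢
  rw [integral_prod _ this]
  simp only [intervalIntegral.integral_of_le Real.pi_pos.le]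

lemma integral_mul_squareMeasure (f g : ℝ → ℝ) :
    ∫ z, f z.1 * g z.2 ∂squareMeasure =
      (∫ x in (0 : ℝ)..Real.pi, f x) * ∫ y in (0 : ℝ)..Real.pi, g y := by
  rw [squareMeasure, integral_prod_mul]
  simp only [intervalIntegral.integral_of_le Real.pi_pos.le]

/-- Termwise integration of the binomial series of `1 / √(1 + X)`. -/
lemma hasSum_integral_one_div_sqrt_one_add {Ω : Type*} [MeasurableSpace Ω] {μ : Measure Ω}
    [IsFiniteMeasure μ] {X : Ω → ℝ} (hX : Measurable X) {ρ : ℝ} (hρ : ρ < 1)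
    (hXρ : ∀ z, |X z| ≤ ρ) :
    HasSum (fun m : ℕ => (-1) ^ m * wallisRatio m * ∫ z, X z ^ m ∂μ)
      (∫ z, 1 / √(1 + X z) ∂μ) := by
  rcases isEmpty_or_nonempty Ω with hΩ | ⟨⟨z₀⟩⟩
  · simp [Measure.eq_zero_of_isEmpty μ, hasSum_zero]
  have hρ0 : 0 ≤ ρ := (abs_nonneg _).trans (hXρ z₀)
  simp_rw [← integral_const_mul]
  refine hasSum_integral_of_dominated_convergence (fun m _ => ρ ^ m)
    (fun m => by fun_prop) (fun m => .of_forall fun z => ?_)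
    (.of_forall fun _ => summable_geometric_of_lt_one hρ0 hρ) (integrable_const _)
    (.of_forall fun z => hasSum_one_div_sqrt_one_add ((hXρ z).trans_lt hρ))
  rw [norm_mul, norm_mul, norm_pow, norm_neg, norm_one, one_pow, one_mul, norm_pow,
    Real.norm_eq_abs, Real.norm_eq_abs, abs_of_pos (wallisRatio_pos m)]
  calc wallisRatio m * |X z| ^ m ≤ 1 * ρ ^ m :=
        mul_le_mul (wallisRatio_le_one m) (pow_le_pow_left₀ (abs_nonneg _) (hXρ z) m)
          (by positivity) zero_le_one
    _ = ρ ^ m := one_mul _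

/-! ### Two double integrals with the same series. -/

/-- The general term of the double series of `∬ 1 / √(9/8 + cos φ cos ψ / √2)`. -/
noncomputable def ringTerm (p : ℕ × ℕ) : ℝ :=
  (-1) ^ p.1 * wallisRatio p.1 *
    ((1 / √2) ^ p.2 * (1 / 8) ^ (p.1 - p.2) * (p.1.choose p.2)) * cosMoment p.2 ^ 2

/-- Supplies the ratio `7 / 8` of a geometric majorant, and keeps the radicand positive. -/
lemma one_div_sqrt_two_add_lt : 1 / √2 + 1 / 8 < (7 / 8 : ℝ) := by
  have : (4 / 3 : ℝ) < √2 := Real.lt_sqrt_of_sq_lt (by norm_num)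
  have : 1 / √2 < (3 / 4 : ℝ) := by
    rw [div_lt_iff₀ (by positivity)]; linarith
  linarith

lemma abs_cos_mul_cos_div_sqrt_two_le (x y : ℝ) :
    |Real.cos x * Real.cos y / √2| ≤ 1 / √2 := by
  rw [abs_div, abs_mul, abs_of_pos (show (0 : ℝ) < √2 by positivity)]
  gcongr
  exact mul_le_one₀ (Real.abs_cos_le_one _) (abs_nonneg _) (Real.abs_cos_le_one _)

/-- Without signs, Wallis ratios and moments, row `m` sums to `(1/√2 + 1/8)^m` by the binomial
theorem. Absolute summability is what permits the regrouping along other rows below. -/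
lemma summable_ringTerm : Summable ringTerm := by
  have hs : ∀ m : ℕ, HasSum (fun k => (1 / √2) ^ k * (1 / 8 : ℝ) ^ (m - k) * (m.choose k))
      ((1 / √2 + 1 / 8) ^ m) := by
    intro m
    rw [add_pow]
    apply hasSum_sum_of_ne_finset_zero
    intro k hk
    rw [Nat.choose_eq_zero_of_lt (by rw [mem_range] at hk; omega)]; simp
  have hb : Summable fun p : ℕ × ℕ =>
      (1 / √2) ^ p.2 * (1 / 8 : ℝ) ^ (p.1 - p.2) * (p.1.choose p.2) := by
    rw [summable_prod_of_nonneg fun p => by positivity]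
    refine ⟨fun m => (hs m).summable, ?_⟩
    simp only [(hs _).tsum_eq]
    exact summable_geometric_of_lt_one (by positivity)
      (one_div_sqrt_two_add_lt.trans (by norm_num))
  refine hb.of_norm_bounded fun p => ?_
  rw [ringTerm, norm_mul, norm_mul, norm_mul, norm_pow, norm_neg, norm_one, one_pow, one_mul,
    Real.norm_eq_abs, abs_of_pos (wallisRatio_pos _), Real.norm_eq_abs, Real.norm_eq_abs,
    abs_of_nonneg (by positivity : 0 ≤ (1 / √2) ^ p.2 * (1 / 8 : ℝ) ^ (p.1 - p.2) *
      (p.1.choose p.2)), abs_pow]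
  have h1 := wallisRatio_le_one p.1
  have h2 : |cosMoment p.2| ^ 2 ≤ 1 := pow_le_one₀ (abs_nonneg _) (abs_cosMoment_le_one _)
  generalize hB : (1 / √2) ^ p.2 * (1 / 8 : ℝ) ^ (p.1 - p.2) * (p.1.choose p.2) = B
  have hB0 : 0 ≤ B := by rw [← hB]; positivity
  calc _ ≤ 1 * B * 1 := by
        gcongr
    _ = B := by ring

/-- Splitting `9/8` as `1 + 1/8` gives a binomial variable of modulus below 1, whose powers expand
into products of cosine moments. The truncated exponent `p.1 - p.2` in `ringTerm` is harmless, since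
the binomial coefficient vanishes there. -/
lemma hasSum_ringTerm :
    HasSum ringTerm ((Real.pi ^ 2)⁻¹ * ∫ z : ℝ × ℝ,
      1 / √(1 + (Real.cos z.1 * Real.cos z.2 / √2 + 1 / 8)) ∂squareMeasure) := by
  have h := hasSum_integral_one_div_sqrt_one_add (μ := squareMeasure)
    (X := fun z : ℝ × ℝ => Real.cos z.1 * Real.cos z.2 / √2 + 1 / 8) (by fun_prop)
    (ρ := 7 / 8) (by norm_num) fun z => by
      refine (abs_add_le _ _).trans ?_
      rw [abs_of_pos (show (0 : ℝ) < 1 / 8 by norm_num)]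
      linarith [one_div_sqrt_two_add_lt, abs_cos_mul_cos_div_sqrt_two_le z.1 z.2]
  have hm : ∀ m : ℕ, ∫ z : ℝ × ℝ,
      (Real.cos z.1 * Real.cos z.2 / √2 + 1 / 8) ^ m ∂squareMeasure =
      ∑ k ∈ range (m + 1), Real.pi ^ 2 * (((1 / √2) ^ k * (1 / 8) ^ (m - k) * (m.choose k)) *
        cosMoment k ^ 2) := by
    intro m
    simp_rw [add_pow]
    rw [integral_finsetSum _ fun k _ => Continuous.integrable_squareMeasure (by fun_prop)]
    refine sum_congr rfl fun k _ => ?_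
    have : ∀ z : ℝ × ℝ, (Real.cos z.1 * Real.cos z.2 / √2) ^ k * (1 / 8) ^ (m - k) *
        (m.choose k : ℝ) = ((1 / √2) ^ k * (1 / 8) ^ (m - k) * (m.choose k)) *
          (Real.cos z.1 ^ k * Real.cos z.2 ^ k) := by
      intro z; rw [div_pow, mul_pow, div_pow, one_pow]; ring
    simp_rw [this]
    rw [integral_const_mul, integral_mul_squareMeasure (fun x => Real.cos x ^ k)
      (fun x => Real.cos x ^ k), integral_cos_pow_eq_cosMoment]
    ring
  have h2 := h.mul_left (Real.pi ^ 2)⁻¹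
  have h3 := summable_ringTerm.hasSum.prod_fiberwise (fun m =>
    hasSum_sum_of_ne_finset_zero (s := range (m + 1)) fun k hk => by
      rw [ringTerm, Nat.choose_eq_zero_of_lt (by rw [mem_range] at hk; simpa using! hk)]; simp)
  convert summable_ringTerm.hasSum using 1
  refine HasSum.unique (f := fun m => ∑ k ∈ range (m + 1), ringTerm (m, k)) ?_ h3
  refine (congrArg (HasSum · _) (funext fun m => ?_)).mp h2
  rw [hm, ← mul_sum]
  have : Real.pi ≠ 0 := Real.pi_ne_zero
  rw [mul_left_comm, inv_mul_cancel_left₀ (by positivity), mul_sum]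
  exact sum_congr rfl fun k _ => by rw [ringTerm]; ring

/-- Odd moments vanish, so only the indices `(n + j, 2j)` contribute; for fixed `n` the sum over `j`
is the balanced one. -/
lemma hasSum_cube_wallisRatio_ring :
    HasSum (fun n : ℕ => (-1) ^ n * (1 / 8) ^ n * wallisRatio n ^ 3)
      ((Real.pi ^ 2)⁻¹ * ∫ z : ℝ × ℝ,
        1 / √(1 + (Real.cos z.1 * Real.cos z.2 / √2 + 1 / 8)) ∂squareMeasure) := by
  have he : Function.Injective fun q : ℕ × ℕ => (q.1 + q.2, 2 * q.2) := by
    rintro ⟨a, b⟩ ⟨c, d⟩ h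
    simp only [Prod.mk.injEq] at h ⊢
    omega
  have h1 := (he.hasSum_iff (f := ringTerm) fun p hp => by
    rcases lt_or_ge p.1 p.2 with hlt | hle
    · simp [ringTerm, Nat.choose_eq_zero_of_lt hlt]
    · rcases Nat.even_or_odd' p.2 with ⟨j, hj | hj⟩
      · exact absurd ⟨(p.1 - j, j), by ext <;> simp <;> omega⟩ hp
      · simp [ringTerm, hj, cosMoment_two_mul_add_one]).2 hasSum_ringTerm
  have h2 := h1.prod_fiberwise fun n =>
    hasSum_sum_of_ne_finset_zero (s := range (n + 1)) fun k hk => by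
      simp only [Function.comp, ringTerm]
      rw [Nat.choose_eq_zero_of_lt (by rw [mem_range] at hk; omega)]; simp
  convert h2 using 2 with n
  rw [← sum_balancedTerm, mul_sum]
  refine sum_congr rfl fun j hj => ?_
  have hjn : j ≤ n := by rw [mem_range] at hj; omega
  simp only [Function.comp, ringTerm, balancedTerm, cosMoment_two_mul]
  rw [show n + j - 2 * j = n - j by omega, pow_mul, div_pow 1 √2, Real.sq_sqrt zero_le_two, pow_add]
  -- The choice of constants matters here: `1/8` is a quarter of `(1/√2)²`, so the powers combine
  -- into the factor `4 ^ j` of `balancedTerm`.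
  have : (1 / 8 : ℝ) ^ n * 4 ^ j = (1 ^ 2 / 2) ^ j * (1 / 8) ^ (n - j) := by
    obtain ⟨d, rfl⟩ := Nat.exists_eq_add_of_le hjn
    rw [Nat.add_sub_cancel_left, pow_add, mul_right_comm, ← mul_pow]
    norm_num
  linear_combination ((-1) ^ n * (-1) ^ j * wallisRatio (n + j) * ((n + j).choose (2 * j)) *
    wallisRatio j ^ 2) * this

/-- The binomial coefficient and the two even moments each contribute one factor `wallisRatio n`. -/
lemma hasSum_cube_wallisRatio_sin :
    HasSum (fun n : ℕ => (-1) ^ n * (1 / 8) ^ n * wallisRatio n ^ 3)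
      ((Real.pi ^ 2)⁻¹ * ∫ z : ℝ × ℝ,
        1 / √(1 + Real.cos z.1 ^ 2 * Real.sin z.2 ^ 2 / 8) ∂squareMeasure) := by
  have h := hasSum_integral_one_div_sqrt_one_add (μ := squareMeasure)
    (X := fun z : ℝ × ℝ => Real.cos z.1 ^ 2 * Real.sin z.2 ^ 2 / 8) (by fun_prop)
    (ρ := 7 / 8) (by norm_num) fun z => by
      rw [abs_of_nonneg (by positivity)]
      have := mul_le_one₀ (Real.cos_sq_le_one z.1) (sq_nonneg _) (Real.sin_sq_le_one z.2)
      linarith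
  refine (congrArg (HasSum · _) (funext fun n => ?_)).mp (h.mul_left (Real.pi ^ 2)⁻¹)
  have : ∀ z : ℝ × ℝ, (Real.cos z.1 ^ 2 * Real.sin z.2 ^ 2 / 8) ^ n =
      (1 / 8) ^ n * (Real.cos z.1 ^ (2 * n) * Real.sin z.2 ^ (2 * n)) := by
    intro z; rw [pow_mul, pow_mul, ← mul_pow, ← mul_pow]; ring
  simp_rw [this]
  rw [integral_const_mul, integral_mul_squareMeasure (fun x => Real.cos x ^ (2 * n))
      (fun x => Real.sin x ^ (2 * n)), integral_cos_pow_eq_cosMoment, integral_sin_pow_even,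
      cosMoment_two_mul, ← wallisRatio]
  have : Real.pi ≠ 0 := Real.pi_ne_zero
  field_simp

theorem integral_ring_eq :
    ∫ x in (0 : ℝ)..Real.pi, ∫ y in (0 : ℝ)..Real.pi,
      1 / √(9 / 8 + Real.cos x * Real.cos y / √2) =
    ∫ x in (0 : ℝ)..Real.pi, ∫ y in (0 : ℝ)..Real.pi,
      1 / √(1 + Real.cos x ^ 2 * Real.sin y ^ 2 / 8) := by
  have h := hasSum_cube_wallisRatio_ring.unique hasSum_cube_wallisRatio_sin
  have hpi : (Real.pi ^ 2)⁻¹ ≠ 0 := by have := Real.pi_ne_zero; positivity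
  have h := mul_left_cancel₀ hpi h
  have pos : ∀ z : ℝ × ℝ, 0 < 1 + (Real.cos z.1 * Real.cos z.2 / √2 + 1 / 8) := by
    intro z
    linarith [one_div_sqrt_two_add_lt, (abs_le.1 (abs_cos_mul_cos_div_sqrt_two_le z.1 z.2)).1]
  have c1 : Continuous fun z : ℝ × ℝ =>
      1 / √(1 + (Real.cos z.1 * Real.cos z.2 / √2 + 1 / 8)) :=
    Continuous.div (by fun_prop) (by fun_prop) fun z => (Real.sqrt_pos.2 (pos z)).ne'
  have c2 : Continuous fun z : ℝ × ℝ => 1 / √(1 + Real.cos z.1 ^ 2 * Real.sin z.2 ^ 2 / 8) :=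
    Continuous.div (by fun_prop) (by fun_prop) fun z => (Real.sqrt_pos.2 (by positivity)).ne'
  rw [integral_squareMeasure c1, integral_squareMeasure c2] at h
  rw [← h]
  refine intervalIntegral.integral_congr fun x _ => intervalIntegral.integral_congr fun y _ => ?_
  simp only
  congr 2
  ring

end Series

/-! ### Rotation invariance and Landen's transformation. -/

lemma continuous_one_div_sqrt {α : Type*} [TopologicalSpace α] {f : α → ℝ} (hf : Continuous f)
    (h : ∀ x, 0 < f x) : Continuous fun x => 1 / √(f x) :=
  continuous_const.div hf.sqrt fun x => (Real.sqrt_pos.2 (h x)).ne'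

lemma exists_polar_angle (q r R : ℝ) (hR : 0 ≤ R) (h : q ^ 2 + r ^ 2 = R ^ 2) :
    ∃ θ : ℝ, q = R * Real.cos θ ∧ r = R * Real.sin θ := by
  have hn : ‖(⟨q, r⟩ : ℂ)‖ = R := by
    rw [Complex.norm_def, Complex.normSq_mk, ← sq, ← sq, h, Real.sqrt_sq hR]
  refine ⟨Complex.arg ⟨q, r⟩, ?_, ?_⟩
  · rw [← hn, Complex.norm_mul_cos_arg]
  · rw [← hn, Complex.norm_mul_sin_arg]

/-- Rotation invariance of the integral over a full period. -/
lemma integral_cos_add_sin (G : ℝ → ℝ) {q r R : ℝ} (hR : 0 ≤ R) (h : q ^ 2 + r ^ 2 = R ^ 2) :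
    ∫ θ in (0 : ℝ)..2 * Real.pi, G (q * Real.cos θ + r * Real.sin θ) =
      ∫ θ in (0 : ℝ)..2 * Real.pi, G (R * Real.cos θ) := by
  obtain ⟨φ, rfl, rfl⟩ := exists_polar_angle q r R hR h
  have h1 : ∀ θ, R * Real.cos φ * Real.cos θ + R * Real.sin φ * Real.sin θ =
      R * Real.cos (θ - φ) := fun θ => by rw [Real.cos_sub]; ring
  simp_rw [h1]
  rw [intervalIntegral.integral_comp_sub_right (fun θ => G (R * Real.cos θ)) φ]
  have hp : Function.Periodic (fun θ => G (R * Real.cos θ)) (2 * Real.pi) := fun θ => by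
    simp only [Real.cos_add_two_pi]
  have := hp.intervalIntegral_add_eq (0 - φ) 0
  rw [zero_add] at this
  rw [← this]
  congr 1; ring

lemma integral_cos_zero_two_pi {G : ℝ → ℝ} (hG : Continuous fun θ => G (Real.cos θ)) :
    ∫ θ in (0 : ℝ)..2 * Real.pi, G (Real.cos θ) =
      2 * ∫ θ in (0 : ℝ)..Real.pi, G (Real.cos θ) := by
  rw [← intervalIntegral.integral_add_adjacent_intervals (hG.intervalIntegrable 0 Real.pi)
    (hG.intervalIntegrable Real.pi (2 * Real.pi)),
    two_mul (∫ θ in (0 : ℝ)..Real.pi, G (Real.cos θ)), add_right_inj]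
  have := intervalIntegral.integral_comp_sub_left (a := 0) (b := Real.pi)
    (fun θ => G (Real.cos θ)) (2 * Real.pi)
  simp only [Real.cos_two_pi_sub, sub_zero] at this
  rw [this]
  congr 1; ring

lemma image_two_mul_arctan {x : ℝ} (hx : 0 < x) :
    (fun w => 2 * Real.arctan (x * w)) '' Set.Ioi 0 = Set.Ioo 0 Real.pi := by
  ext β
  constructor
  · rintro ⟨w, hw, rfl⟩
    have h1 := Real.arctan_pos.2 (mul_pos hx hw)
    have h2 := Real.arctan_lt_pi_div_two (x * w)
    exact ⟨by linarith, by dsimp only; linarith⟩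
  · rintro ⟨h0, h1⟩
    refine ⟨Real.tan (β / 2) / x,
      div_pos (Real.tan_pos_of_pos_of_lt_pi_div_two (by linarith) (by linarith)) hx, ?_⟩
    dsimp only
    rw [mul_div_cancel₀ _ hx.ne', Real.arctan_tan (by linarith) (by linarith)]
    ring

/-- The half-angle substitution `β = 2 arctan (x w)`. -/
lemma integral_zero_pi_eq_integral_Ioi (g : ℝ → ℝ) {x : ℝ} (hx : 0 < x) :
    ∫ β in (0 : ℝ)..Real.pi, g β =
      ∫ w in Set.Ioi (0 : ℝ), 2 * x / (1 + (x * w) ^ 2) * g (2 * Real.arctan (x * w)) := by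
  rw [intervalIntegral.integral_of_le Real.pi_pos.le, integral_Ioc_eq_integral_Ioo,
    ← image_two_mul_arctan hx,
    integral_image_eq_integral_abs_deriv_smul (f' := fun w => 2 * x / (1 + (x * w) ^ 2))
      measurableSet_Ioi]
  · refine setIntegral_congr_fun measurableSet_Ioi fun w _ => ?_
    rw [smul_eq_mul, abs_of_pos (by positivity)]
  · intro w _
    exact ((((hasDerivAt_id' w).const_mul x).arctan.const_mul 2).congr_deriv
      (by ring)).hasDerivWithinAt
  · intro a _ b _ h
    exact mul_left_cancel₀ hx.ne' (Real.arctan_injective (mul_left_cancel₀ two_ne_zero h))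

lemma cos_two_mul_arctan (u : ℝ) : Real.cos (2 * Real.arctan u) = (1 - u ^ 2) / (1 + u ^ 2) := by
  have : (1 + u ^ 2) ≠ 0 := by positivity
  rw [Real.cos_two_mul, Real.cos_sq_arctan]; field_simp; ring

lemma sin_two_mul_arctan (u : ℝ) : Real.sin (2 * Real.arctan u) = 2 * u / (1 + u ^ 2) := by
  rw [Real.sin_two_mul, Real.sin_arctan, Real.cos_arctan, mul_assoc, div_mul_div_comm, mul_one,
    Real.mul_self_sqrt (by positivity), mul_div_assoc]

/-- A form of Landen's transformation. -/
theorem integral_one_div_sqrt_add_mul_cos {p R : ℝ} (hp : 1 ≤ p) (hR : 0 ≤ R)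
    (h : p ^ 2 - R ^ 2 = 1) :
    ∫ β in (0 : ℝ)..Real.pi, 1 / √(p + R * Real.cos β) =
      ∫ θ in (0 : ℝ)..Real.pi, 1 / √(1 + (p - 1) / 2 * Real.sin θ ^ 2) := by
  -- With this scale, `β = 2 arctan (x w)` and `θ = 2 arctan w` turn both sides into the same
  -- integral in `w`; the relation `p - R = 1 / x²` is what matches them.
  set x := √(p + R) with hxdef
  have hpR : 0 < p + R := by linarith
  have hx : 0 < x := Real.sqrt_pos.2 hpR
  have hx2 : x ^ 2 = p + R := Real.sq_sqrt hpR.le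
  have hx2' : (p - R) * x ^ 2 = 1 := by rw [hx2]; linarith
  rw [integral_zero_pi_eq_integral_Ioi _ hx, integral_zero_pi_eq_integral_Ioi _ one_pos]
  refine setIntegral_congr_fun measurableSet_Ioi fun w (hw : 0 < w) => ?_
  rw [cos_two_mul_arctan, sin_two_mul_arctan, one_mul]
  have hA : 0 < 1 + (x * w) ^ 2 := by positivity
  have hB : 0 < 1 + w ^ 2 := by positivity
  have e1 : p + R * ((1 - (x * w) ^ 2) / (1 + (x * w) ^ 2)) =
      (x ^ 2 + w ^ 2) / (1 + (x * w) ^ 2) := by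
    field_simp
    linear_combination (w ^ 2) * hx2' - hx2
  have e2 : 1 + (p - 1) / 2 * (2 * w / (1 + w ^ 2)) ^ 2 =
      (x ^ 2 + w ^ 2) * (1 + (x * w) ^ 2) / (x * (1 + w ^ 2)) ^ 2 := by
    field_simp
    linear_combination (-w ^ 2 * x ^ 2) * hx2 + (w ^ 2) * hx2'
  rw [e1, e2, Real.sqrt_div (by positivity), Real.sqrt_div (by positivity),
    Real.sqrt_mul (by positivity), Real.sqrt_sq (by positivity)]
  have hs : √(1 + (x * w) ^ 2) ^ 2 = 1 + (x * w) ^ 2 := Real.sq_sqrt hA.le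
  have hs0 : √(1 + (x * w) ^ 2) ≠ 0 := (Real.sqrt_pos.2 hA).ne'
  have ht0 : √(x ^ 2 + w ^ 2) ≠ 0 := (Real.sqrt_pos.2 (by positivity)).ne'
  generalize √(1 + (x * w) ^ 2) = s at *
  rw [← hs]
  field_simp

/-! ### The product formula for a spherical function. -/

/-- The squared norm `|g k g v|²` for the diagonal matrix `g = diag(√√2, 1 / √√2)`, the rotation `k`
by the angle `α / 2` and the unit vector `v` of angle `β / 2`. -/
noncomputable def twistedForm (α β : ℝ) : ℝ :=
  9 / 8 + 3 / 8 * Real.cos β + Real.cos α * (1 / 8 + 3 / 8 * Real.cos β) -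
    √2 / 4 * Real.sin α * Real.sin β

/-- In `α` the form is a sinusoid of amplitude `(3 + cos β) / 8` about a mean three times as large,
so it factors into positive terms. -/
lemma twistedForm_pos (α β : ℝ) : 0 < twistedForm α β := by
  have h2 : (√2) ^ 2 = 2 := Real.sq_sqrt zero_le_two
  have ha := Real.sin_sq_add_cos_sq α
  have hb := Real.sin_sq_add_cos_sq β
  have hc := Real.neg_one_le_cos β
  obtain ⟨θ, h1, h3⟩ := exists_polar_angle (1 / 8 + 3 / 8 * Real.cos β) (-(√2 / 4 * Real.sin β))
    ((3 + Real.cos β) / 8) (by linarith)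
    (by linear_combination (1 / 8) * hb + Real.sin β ^ 2 / 16 * h2)
  have : twistedForm α β = (3 + Real.cos β) / 8 * (3 + Real.cos (α - θ)) := by
    rw [twistedForm, Real.cos_sub]
    linear_combination Real.cos α * h1 + Real.sin α * h3
  rw [this]
  have := Real.neg_one_le_cos (α - θ)
  exact mul_pos (by linarith) (by linarith)

/-- The period `∫_0^π dα / √(3 + cos α)`, a multiple of the lemniscate constant. -/
noncomputable def lemniscatePeriod : ℝ := ∫ α in (0 : ℝ)..Real.pi, 1 / √(3 + Real.cos α)

lemma three_add_cos_pos (α : ℝ) : 0 < 3 + Real.cos α := by linarith [Real.neg_one_le_cos α]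

/-- Averaging over the rotation forgets the direction of `g v`, so only `|g v|² = (3 + cos β) / √8`
remains, multiplied by the period. -/
lemma integral_twistedForm_left (β : ℝ) :
    ∫ α in (0 : ℝ)..2 * Real.pi, 1 / √(twistedForm α β) =
      2 * √8 * lemniscatePeriod * (1 / √(3 + Real.cos β)) := by
  have h2 : (√2) ^ 2 = 2 := Real.sq_sqrt zero_le_two
  have hb := Real.sin_sq_add_cos_sq β
  have hc := three_add_cos_pos β
  have h := integral_cos_add_sin (fun y => 1 / √((9 + 3 * Real.cos β) / 8 + y))
    (q := 1 / 8 + 3 / 8 * Real.cos β) (r := -(√2 / 4 * Real.sin β))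
    (R := (3 + Real.cos β) / 8) (by linarith)
    (by linear_combination (1/8) * hb + Real.sin β ^ 2 / 16 * h2)
  have e : ∀ α, twistedForm α β = (9 + 3 * Real.cos β) / 8 +
      ((1 / 8 + 3 / 8 * Real.cos β) * Real.cos α + -(√2 / 4 * Real.sin β) * Real.sin α) := by
    intro α; rw [twistedForm]; ring
  simp_rw [e]
  rw [h]
  have e2 : ∀ α, 1 / √((9 + 3 * Real.cos β) / 8 + (3 + Real.cos β) / 8 * Real.cos α) =
      √8 * (1 / √(3 + Real.cos β)) * (1 / √(3 + Real.cos α)) := by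
    intro α
    rw [show (9 + 3 * Real.cos β) / 8 + (3 + Real.cos β) / 8 * Real.cos α =
      (3 + Real.cos β) * (3 + Real.cos α) / 8 by ring,
      Real.sqrt_div (mul_nonneg hc.le (three_add_cos_pos α).le), Real.sqrt_mul hc.le, one_div_div]
    field_simp
  simp_rw [e2]
  rw [intervalIntegral.integral_const_mul, integral_cos_zero_two_pi (G := fun c => 1 / √(3 + c))
    (continuous_one_div_sqrt (by fun_prop) three_add_cos_pos), ← lemniscatePeriod]
  ring

/-- For a fixed rotation, `g k g` has determinant 1, so in `β` the form has mean `p` and amplitude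
`R` with `p² - R² = 1`, as Landen's transformation requires. -/
lemma integral_twistedForm_right (α : ℝ) :
    ∫ β in (0 : ℝ)..2 * Real.pi, 1 / √(twistedForm α β) =
      2 * ∫ θ in (0 : ℝ)..Real.pi, 1 / √(1 + Real.cos (α / 2) ^ 2 * Real.sin θ ^ 2 / 8) := by
  have h2 : (√2) ^ 2 = 2 := Real.sq_sqrt zero_le_two
  have ha := Real.sin_sq_add_cos_sq α
  have hc := Real.neg_one_le_cos α
  set p := (9 + Real.cos α) / 8 with hp
  have hp1 : 1 ≤ p := by rw [hp]; linarith
  set R := √(p ^ 2 - 1) with hRd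
  have hR0 : 0 ≤ R := Real.sqrt_nonneg _
  have hR2 : R ^ 2 = p ^ 2 - 1 := Real.sq_sqrt (by nlinarith)
  have hRp : R < p := by nlinarith
  have h := integral_cos_add_sin (fun y => 1 / √(p + y))
    (q := 3 / 8 * (1 + Real.cos α)) (r := -(√2 / 4 * Real.sin α)) hR0
    (by rw [hR2, hp]; linear_combination (1/8) * ha + Real.sin α ^ 2 / 16 * h2)
  have e : ∀ β, twistedForm α β = p +
      (3 / 8 * (1 + Real.cos α) * Real.cos β + -(√2 / 4 * Real.sin α) * Real.sin β) := by
    intro β; rw [twistedForm, hp]; ring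
  simp_rw [e]
  rw [h, integral_cos_zero_two_pi (G := fun c => 1 / √(p + R * c))
    (continuous_one_div_sqrt (by fun_prop) fun θ => by nlinarith [Real.neg_one_le_cos θ]),
    integral_one_div_sqrt_add_mul_cos hp1 hR0 (by linarith)]
  have e3 : ∀ θ, (p - 1) / 2 * Real.sin θ ^ 2 = Real.cos (α / 2) ^ 2 * Real.sin θ ^ 2 / 8 := by
    intro θ
    rw [Real.cos_sq, mul_div_cancel₀ _ (two_ne_zero' ℝ), hp]; ring
  simp_rw [e3]

/-- The product formula for the spherical function `g ↦ ∫ |g v|⁻¹ dv` at `g = diag(√√2, 1 / √√2)`. -/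
theorem integral_integral_eq_lemniscatePeriod_sq :
    ∫ x in (0 : ℝ)..Real.pi, ∫ y in (0 : ℝ)..Real.pi,
      1 / √(1 + Real.cos x ^ 2 * Real.sin y ^ 2 / 8) = √8 * lemniscatePeriod ^ 2 := by
  -- Integrating `twistedForm` in the two orders gives the two sides.
  have hswap := intervalIntegral_intervalIntegral_swap (a := 0) (b := 2 * Real.pi) (c := 0)
    (d := 2 * Real.pi) (F := fun α β => 1 / √(twistedForm α β)) (by
      have hc : Continuous (Function.uncurry fun α β => 1 / √(twistedForm α β)) :=
        continuous_one_div_sqrt (f := fun z : ℝ × ℝ => twistedForm z.1 z.2)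
          (by unfold twistedForm; fun_prop) fun z => twistedForm_pos _ _
      rw [Set.uIoc_of_le Real.two_pi_pos.le]
      exact (hc.continuousOn.integrableOn_compact (isCompact_Icc.prod isCompact_Icc)).mono_set
        (Set.prod_mono Set.Ioc_subset_Icc_self Set.Ioc_subset_Icc_self))
  simp_rw [integral_twistedForm_left, integral_twistedForm_right] at hswap
  rw [intervalIntegral.integral_const_mul, intervalIntegral.integral_const_mul,
    integral_cos_zero_two_pi (G := fun c => 1 / √(3 + c))
      (continuous_one_div_sqrt (by fun_prop) three_add_cos_pos), ← lemniscatePeriod,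
    intervalIntegral.integral_comp_div (fun a => ∫ θ in (0 : ℝ)..Real.pi,
      1 / √(1 + Real.cos a ^ 2 * Real.sin θ ^ 2 / 8)) two_ne_zero, zero_div,
    mul_div_cancel_left₀ _ (two_ne_zero' ℝ), smul_eq_mul] at hswap
  linarith

/-! ### The lemniscate period in terms of the gamma function. -/

lemma image_cos_half_pow_four :
    (fun α => Real.cos (α / 2) ^ 4) '' Set.Ioo 0 Real.pi = Set.Ioo 0 1 := by
  ext s
  constructor
  · rintro ⟨α, ⟨h0, h1⟩, rfl⟩
    have hc : 0 < Real.cos (α / 2) := Real.cos_pos_of_mem_Ioo ⟨by linarith, by linarith⟩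
    have hc1 : Real.cos (α / 2) < 1 := by
      have := Real.cos_lt_cos_of_nonneg_of_le_pi_div_two le_rfl
        (show α / 2 ≤ Real.pi / 2 by linarith) (by linarith)
      rwa [Real.cos_zero] at this
    exact ⟨by positivity, pow_lt_one₀ hc.le hc1 (by norm_num)⟩
  · rintro ⟨h0, h1⟩
    have hr0 : 0 < √√s := Real.sqrt_pos.2 (Real.sqrt_pos.2 h0)
    have hr1 : √√s < 1 := by
      rw [Real.sqrt_lt' one_pos, Real.sqrt_lt' (by norm_num)]; linarith
    refine ⟨2 * Real.arccos √√s, ⟨by linarith [Real.arccos_pos.2 hr1], ?_⟩, ?_⟩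
    · linarith [Real.arccos_lt_pi_div_two.2 hr0]
    · dsimp only
      rw [mul_div_cancel_left₀ _ (two_ne_zero' ℝ), Real.cos_arccos (by linarith) hr1.le,
        show (4 : ℕ) = 2 * 2 by norm_num, pow_mul, Real.sq_sqrt (Real.sqrt_nonneg _),
        Real.sq_sqrt h0.le]

/-- Substitute `s = cos⁴(α/2)` in `∫ s^(-3/4) (1 - s)^(-1/2) ds`, using `3 + cos α = 2 (1 +
cos²(α/2))`. The integral enters through the total mass 1 of the beta density. -/
lemma beta_quarter_half :
    ProbabilityTheory.beta (1 / 4) (1 / 2) = 2 * √2 * lemniscatePeriod := by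
  have hB := ProbabilityTheory.beta_pos (α := 1 / 4) (β := 1 / 2) (by norm_num) (by norm_num)
  have h := ProbabilityTheory.lintegral_betaPDF_eq_one (α := 1 / 4) (β := 1 / 2)
    (by norm_num) (by norm_num)
  have hpos : ∀ α ∈ Set.Ioo 0 Real.pi, 0 < Real.cos (α / 2) ∧ 0 < Real.sin (α / 2) := by
    rintro α ⟨h0, h1⟩
    exact ⟨Real.cos_pos_of_mem_Ioo ⟨by linarith, by linarith⟩,
      Real.sin_pos_of_pos_of_lt_pi (by linarith) (by linarith)⟩
  rw [ProbabilityTheory.lintegral_betaPDF] at h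
  generalize ProbabilityTheory.beta (1 / 4) (1 / 2) = B at *
  rw [← image_cos_half_pow_four,
    lintegral_image_eq_lintegral_abs_deriv_mul
      (f' := fun α => -(2 * Real.cos (α / 2) ^ 3 * Real.sin (α / 2))) measurableSet_Ioo] at h
  rotate_left
  · intro α _
    exact (((((hasDerivAt_id' α).div_const 2).cos).pow 4).congr_deriv
      (by push_cast; ring)).hasDerivWithinAt
  · intro a ha b hb hab
    have h1 := (pow_left_inj₀ (hpos a ha).1.le (hpos b hb).1.le (by norm_num)).1 hab
    have h2 := Real.injOn_cos ⟨by linarith [ha.1], by linarith [ha.1, ha.2]⟩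
      ⟨by linarith [hb.1], by linarith [hb.1, hb.2]⟩ h1
    linarith
  rw [setLIntegral_congr_fun (g := fun α => ENNReal.ofReal (2 * √2 / B * (1 / √(3 + Real.cos α))))
    measurableSet_Ioo] at h
  rotate_left
  · intro α hα
    obtain ⟨hc, hs⟩ := hpos α hα
    dsimp only
    have hcos : 3 + Real.cos α = 2 * (1 + Real.cos (α / 2) ^ 2) := by
      rw [Real.cos_sq (α / 2), mul_div_cancel₀ _ (two_ne_zero' ℝ)]; ring
    have hsc := Real.sin_sq_add_cos_sq (α / 2)
    rw [hcos]
    generalize Real.cos (α / 2) = c at *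
    generalize Real.sin (α / 2) = s at *
    rw [← ENNReal.ofReal_mul (abs_nonneg _)]
    congr 1
    have r1 : (c ^ 4 : ℝ) ^ (1 / 4 - 1 : ℝ) = (c ^ 3)⁻¹ := by
      rw [← Real.rpow_natCast, ← Real.rpow_mul hc.le, ← Real.rpow_natCast, ← Real.rpow_neg hc.le]
      norm_num
    have r2 : (1 - c ^ 4 : ℝ) ^ (1 / 2 - 1 : ℝ) = (s * √(1 + c ^ 2))⁻¹ := by
      rw [show (1 - c ^ 4 : ℝ) = s ^ 2 * (1 + c ^ 2) by linear_combination (-1 - c ^ 2) * hsc,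
        show (1 / 2 - 1 : ℝ) = -(1 / 2) by norm_num, Real.rpow_neg (by positivity),
        ← Real.sqrt_eq_rpow, Real.sqrt_mul (by positivity), Real.sqrt_sq hs.le]
    rw [r1, r2, abs_neg, abs_of_pos (by positivity), Real.sqrt_mul zero_le_two]
    have : √(1 + c ^ 2) ≠ 0 := (Real.sqrt_pos.2 (by positivity)).ne'
    field_simp
  rw [← ofReal_integral_eq_lintegral_ofReal, integral_const_mul, ← integral_Ioc_eq_integral_Ioo,
    ← intervalIntegral.integral_of_le Real.pi_pos.le, ← lemniscatePeriod, ENNReal.ofReal_eq_one] at h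
  · field_simp at h; linarith
  · have hc : Continuous fun α => 2 * √2 / B * (1 / √(3 + Real.cos α)) :=
      continuous_const.mul (continuous_one_div_sqrt (by fun_prop) three_add_cos_pos)
    exact (hc.integrableOn_Icc).mono_set Set.Ioo_subset_Icc_self
  · exact .of_forall fun α => by positivity

/-- The beta value contains `Γ(3/4)`, which the reflection formula `Γ(1/4) Γ(3/4) = √2 π` removes.
-/
theorem sqrt_eight_mul_lemniscatePeriod_sq :
    √8 * lemniscatePeriod ^ 2 = Real.Gamma (1 / 4) ^ 4 / (4 * √2 * Real.pi) := by
  have h := beta_quarter_half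
  have hr := Real.Gamma_mul_Gamma_one_sub (1 / 4)
  rw [show Real.pi * (1 / 4) = Real.pi / 4 by ring, Real.sin_pi_div_four] at hr
  rw [ProbabilityTheory.beta, Real.Gamma_one_half_eq,
    show (1 / 4 + 1 / 2 : ℝ) = 1 - 1 / 4 by norm_num] at h
  have h3 : 0 < Real.Gamma (1 - 1 / 4) := Real.Gamma_pos_of_pos (by norm_num)
  have h2 : (√2) ^ 2 = 2 := Real.sq_sqrt zero_le_two
  have h8 : √8 = 2 * √2 := by
    rw [show (8 : ℝ) = 2 ^ 2 * 2 by norm_num, Real.sqrt_mul (by norm_num), Real.sqrt_sq zero_le_two]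
  have hp : √Real.pi ^ 2 = Real.pi := Real.sq_sqrt Real.pi_pos.le
  have hq : 0 < √Real.pi := Real.sqrt_pos.2 Real.pi_pos
  have hg1 : 0 < Real.Gamma (1 / 4) := Real.Gamma_pos_of_pos (by norm_num)
  generalize Real.Gamma (1 / 4) = g at *
  generalize Real.Gamma (1 - 1 / 4) = g' at *
  rw [← hp] at hr ⊢
  generalize √Real.pi = q at *
  have hs : 0 < √2 := by positivity
  have hg' : g' = q ^ 2 * √2 / g := by
    field_simp at hr ⊢
    linear_combination (√2 / 2) * hr - g * g' / 2 * h2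
  have hL : lemniscatePeriod = g ^ 2 / (4 * q) := by
    rw [hg'] at h
    field_simp at h ⊢
    rw [h2] at h
    linarith
  rw [hL, h8]
  field_simp
  linarith

/-! ### The law of a product of two cosines. -/

lemma setLIntegral_eq_of_subset_of_forall_diff_eq_zero {α : Type*} [MeasurableSpace α]
    {μ : Measure α} {s t : Set α} (hs : MeasurableSet s) (ht : MeasurableSet t) (hst : s ⊆ t)
    {f : α → ENNReal} (hf : ∀ x ∈ t \ s, f x = 0) : ∫⁻ x in t, f x ∂μ = ∫⁻ x in s, f x ∂μ := by
  rw [← lintegral_indicator ht, ← lintegral_indicator hs]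
  refine lintegral_congr fun x => ?_
  by_cases hxs : x ∈ s
  · rw [Set.indicator_of_mem hxs, Set.indicator_of_mem (hst hxs)]
  · rw [Set.indicator_of_notMem hxs]
    by_cases hxt : x ∈ t
    · rw [Set.indicator_of_mem hxt, hf x ⟨hxt, hxs⟩]
    · rw [Set.indicator_of_notMem hxt]

lemma ofReal_intervalIntegral {f : ℝ → ℝ} (hf : Continuous f) (h0 : ∀ x, 0 ≤ f x) {a b : ℝ}
    (hab : a ≤ b) :
    ENNReal.ofReal (∫ x in a..b, f x) = ∫⁻ x in Set.Ioo a b, ENNReal.ofReal (f x) := by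
  rw [← ofReal_integral_eq_lintegral_ofReal (hf.integrableOn_Icc.mono_set Set.Ioo_subset_Icc_self)
    (.of_forall h0), ← integral_Ioc_eq_integral_Ioo, intervalIntegral.integral_of_le hab]

lemma image_arcsin_mul_sin {k : ℝ} (h0 : 0 < k) (h1 : k < 1) :
    (fun θ => Real.arcsin (k * Real.sin θ)) '' Set.Ioo 0 (Real.pi / 2) =
      Set.Ioo 0 (Real.arcsin k) := by
  have hpi := Real.pi_pos
  ext ψ
  constructor
  · rintro ⟨θ, ⟨ht0, ht1⟩, rfl⟩
    have hs0 : 0 < Real.sin θ := Real.sin_pos_of_pos_of_lt_pi ht0 (by linarith)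
    have hs1 : Real.sin θ < 1 := by
      have := Real.sin_lt_sin_of_lt_of_le_pi_div_two (by linarith) le_rfl ht1
      rwa [Real.sin_pi_div_two] at this
    have hks : k * Real.sin θ < k := by nlinarith
    exact ⟨Real.arcsin_pos.2 (by positivity),
      Real.strictMonoOn_arcsin ⟨by nlinarith, by linarith⟩ ⟨by linarith, h1.le⟩ hks⟩
  · rintro ⟨hψ0, hψ1⟩
    have hk2 := Real.arcsin_le_pi_div_two k
    have hs0 : 0 < Real.sin ψ := Real.sin_pos_of_pos_of_lt_pi hψ0 (by linarith)
    have hsk : Real.sin ψ < k := by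
      rw [← Real.lt_arcsin_iff_sin_lt' ⟨by linarith, by linarith⟩]
      exact hψ1
    refine ⟨Real.arcsin (Real.sin ψ / k), ⟨Real.arcsin_pos.2 (by positivity), ?_⟩, ?_⟩
    · rw [Real.arcsin_lt_pi_div_two, div_lt_one h0]; exact hsk
    · dsimp only
      rw [Real.sin_arcsin (by linarith [div_pos hs0 h0]) ((div_lt_one h0).2 hsk).le,
        mul_div_cancel₀ _ h0.ne', Real.arcsin_sin (by linarith) (by linarith)]

/-- The substitution `sin ψ = k sin θ` in the complete elliptic integral of complementary
modulus `u`; the integrand on the right vanishes where `cos ψ ≤ |u|`. -/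
lemma ofReal_ellipticK_sqrt_one_sub_sq {u : ℝ} (h0 : u ≠ 0) (h1 : u ^ 2 < 1) :
    ENNReal.ofReal (ellipticK √(1 - u ^ 2)) =
      ∫⁻ ψ in Set.Ioo 0 (Real.pi / 2), ENNReal.ofReal (1 / √(Real.cos ψ ^ 2 - u ^ 2)) := by
  have hpi := Real.pi_pos
  have hu : 0 < u ^ 2 := by positivity
  set k := √(1 - u ^ 2) with hk
  have hk0 : 0 < k := Real.sqrt_pos.2 (by linarith)
  have hk2 : k ^ 2 = 1 - u ^ 2 := Real.sq_sqrt (by linarith)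
  have hk1 : k < 1 := by nlinarith
  have hak : Real.arcsin k ≤ Real.pi / 2 := Real.arcsin_le_pi_div_two k
  rw [setLIntegral_eq_of_subset_of_forall_diff_eq_zero (s := Set.Ioo 0 (Real.arcsin k))
    measurableSet_Ioo measurableSet_Ioo (Set.Ioo_subset_Ioo_right hak),
    ← image_arcsin_mul_sin hk0 hk1,
    lintegral_image_eq_lintegral_abs_deriv_mul
      (f' := fun θ => 1 / √(1 - (k * Real.sin θ) ^ 2) * (k * Real.cos θ)) measurableSet_Ioo]
  · have hpos : ∀ θ, 0 < 1 - k ^ 2 * Real.sin θ ^ 2 := fun θ => by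
      nlinarith [Real.sin_sq_le_one θ, sq_nonneg (Real.sin θ)]
    rw [ellipticK, ofReal_intervalIntegral (continuous_one_div_sqrt (by fun_prop) hpos)
      (fun _ => by positivity) (by positivity)]
    refine setLIntegral_congr_fun measurableSet_Ioo fun θ hθ => ?_
    have hc : 0 < Real.cos θ := Real.cos_pos_of_mem_Ioo ⟨by linarith [hθ.1], hθ.2⟩
    have hsc := Real.sin_sq_add_cos_sq θ
    have hp := hpos θ
    have hs1 : |k * Real.sin θ| ≤ 1 := abs_le_one_iff_mul_self_le_one.2 (by nlinarith)
    rw [← ENNReal.ofReal_mul (abs_nonneg _), Real.cos_arcsin,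
      Real.sq_sqrt (show 0 ≤ 1 - (k * Real.sin θ) ^ 2 by rw [mul_pow]; exact hp.le),
      abs_of_nonneg (by positivity),
      show 1 - (k * Real.sin θ) ^ 2 - u ^ 2 = (k * Real.cos θ) ^ 2 by
        linear_combination (-k ^ 2) * hsc - hk2, Real.sqrt_sq (by positivity), mul_pow]
    congr 1
    field_simp
  · intro θ hθ
    have hs1 : (k * Real.sin θ) ^ 2 < 1 := by
      nlinarith [Real.sin_sq_le_one θ, sq_nonneg (Real.sin θ)]
    have hs := abs_lt.1 ((sq_lt_one_iff_abs_lt_one _).1 hs1)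
    exact ((Real.hasDerivAt_arcsin hs.1.ne' hs.2.ne).comp θ
      ((Real.hasDerivAt_sin θ).const_mul k)).hasDerivWithinAt
  · intro a ha b hb hab
    have hs : ∀ θ, k * Real.sin θ ∈ Set.Icc (-1 : ℝ) 1 := fun θ =>
      ⟨by nlinarith [Real.neg_one_le_sin θ], by nlinarith [Real.sin_le_one θ]⟩
    have h2 := mul_left_cancel₀ hk0.ne' (Real.injOn_arcsin (hs a) (hs b) hab)
    exact Real.injOn_sin ⟨by linarith [ha.1], ha.2.le⟩ ⟨by linarith [hb.1], hb.2.le⟩ h2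
  -- Beyond `arcsin k` the radicand is nonpositive, so the conventions `√y = 0` for `y ≤ 0` and `1 /
  -- 0 = 0` make the integrand vanish.
  · rintro ψ ⟨⟨hψ0, hψ1⟩, hψ⟩
    have hψ2 : Real.arcsin k ≤ ψ := by
      by_contra hlt; exact hψ ⟨hψ0, not_le.1 hlt⟩
    have hks : k ≤ Real.sin ψ :=
      (Real.arcsin_le_iff_le_sin' ⟨by linarith, by linarith⟩).1 hψ2
    have hsc := Real.sin_sq_add_cos_sq ψ
    rw [Real.sqrt_eq_zero_of_nonpos (by nlinarith), div_zero, ENNReal.ofReal_zero]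

/-- The substitution `u = c cos φ`. -/
lemma lintegral_mul_one_div_sqrt_sq_sub_sq (F : ℝ → ℝ) {c : ℝ} (h0 : 0 < c) (h1 : c ≤ 1) :
    ∫⁻ u in Set.Ioo (-1 : ℝ) 1, ENNReal.ofReal (F u) * ENNReal.ofReal (1 / √(c ^ 2 - u ^ 2)) =
      ∫⁻ φ in Set.Ioo 0 Real.pi, ENNReal.ofReal (F (c * Real.cos φ)) := by
  have himg : (fun φ => c * Real.cos φ) '' Set.Ioo 0 Real.pi = Set.Ioo (-c) c := by
    ext u
    constructor
    · rintro ⟨φ, ⟨hφ0, hφ1⟩, rfl⟩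
      have ha := Real.cos_lt_cos_of_nonneg_of_le_pi le_rfl hφ1.le hφ0
      have hb := Real.cos_lt_cos_of_nonneg_of_le_pi hφ0.le le_rfl hφ1
      rw [Real.cos_zero] at ha
      rw [Real.cos_pi] at hb
      exact ⟨by nlinarith, by nlinarith⟩
    · rintro ⟨hu0, hu1⟩
      have ha : u / c < 1 := (div_lt_one h0).2 hu1
      have hb : -1 < u / c := by rw [lt_div_iff₀ h0]; linarith
      refine ⟨Real.arccos (u / c), ⟨Real.arccos_pos.2 ha, ?_⟩, ?_⟩
      · refine lt_of_le_of_ne (Real.arccos_le_pi _) fun h => ?_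
        rw [Real.arccos_eq_pi] at h; linarith
      · dsimp only
        rw [Real.cos_arccos hb.le ha.le, mul_div_cancel₀ _ h0.ne']
  rw [setLIntegral_eq_of_subset_of_forall_diff_eq_zero (s := Set.Ioo (-c) c)
    measurableSet_Ioo measurableSet_Ioo (Set.Ioo_subset_Ioo (by linarith) h1), ← himg,
    lintegral_image_eq_lintegral_abs_deriv_mul
      (f' := fun φ => c * -Real.sin φ) measurableSet_Ioo]
  · refine setLIntegral_congr_fun measurableSet_Ioo fun φ hφ => ?_
    have hs : 0 < Real.sin φ := Real.sin_pos_of_pos_of_lt_pi hφ.1 hφ.2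
    rw [show c ^ 2 - (c * Real.cos φ) ^ 2 = (c * Real.sin φ) ^ 2 by
        linear_combination (-c ^ 2) * Real.sin_sq_add_cos_sq φ, Real.sqrt_sq (by positivity),
      mul_neg, abs_neg, abs_of_pos (by positivity), mul_left_comm,
      ← ENNReal.ofReal_mul (by positivity), mul_one_div_cancel (by positivity),
      ENNReal.ofReal_one, mul_one]
  · intro φ _
    exact ((Real.hasDerivAt_cos φ).const_mul c).hasDerivWithinAt
  · intro a ha b hb hab
    exact Real.injOn_cos ⟨ha.1.le, ha.2.le⟩ ⟨hb.1.le, hb.2.le⟩ (mul_left_cancel₀ h0.ne' hab)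
  · rintro u ⟨_, hu⟩
    have : c ^ 2 - u ^ 2 ≤ 0 := by
      by_contra hlt
      exact hu (abs_lt.1 (abs_lt_of_sq_lt_sq (by linarith) h0.le))
    rw [Real.sqrt_eq_zero_of_nonpos this, div_zero, ENNReal.ofReal_zero, mul_zero]

lemma stronglyMeasurable_ellipticK : StronglyMeasurable ellipticK := by
  unfold ellipticK
  simp_rw [intervalIntegral.integral_of_le (show (0 : ℝ) ≤ Real.pi / 2 by positivity)]
  exact StronglyMeasurable.integral_prod_right
    (f := fun k θ => 1 / √(1 - k ^ 2 * Real.sin θ ^ 2))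
    (Measurable.stronglyMeasurable (by unfold Function.uncurry; fun_prop))

lemma ellipticK_nonneg (k : ℝ) : 0 ≤ ellipticK k :=
  intervalIntegral.integral_nonneg (by positivity) fun _ _ => by positivity

/-- The law of `cos φ cos ψ` for uniform independent angles has density proportional to the
complete elliptic integral. -/
lemma lintegral_ellipticK_mul {F : ℝ → ℝ} (hF : Measurable F) (hF0 : ∀ u, 0 ≤ F u)
    (hFc : Continuous fun z : ℝ × ℝ => F (Real.cos z.1 * Real.cos z.2)) :
    ∫⁻ u in Set.Ioo (-1 : ℝ) 1, ENNReal.ofReal (F u * ellipticK √(1 - u ^ 2)) =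
      ENNReal.ofReal (∫ ψ in (0 : ℝ)..Real.pi / 2, ∫ φ in (0 : ℝ)..Real.pi,
        F (Real.cos ψ * Real.cos φ)) := by
  have hpi := Real.pi_pos
  have e1 : ∫⁻ u in Set.Ioo (-1 : ℝ) 1, ENNReal.ofReal (F u * ellipticK √(1 - u ^ 2)) =
      ∫⁻ u in Set.Ioo (-1 : ℝ) 1, ∫⁻ ψ in Set.Ioo 0 (Real.pi / 2),
        ENNReal.ofReal (F u) * ENNReal.ofReal (1 / √(Real.cos ψ ^ 2 - u ^ 2)) := by
    -- The null point `u = 0` is dropped: the modulus there is 1, where the elliptic integral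
    -- diverges.
    refine setLIntegral_congr_fun_ae measurableSet_Ioo ?_
    filter_upwards [compl_mem_ae_iff.2 (measure_singleton (0 : ℝ))] with u hu hu1
    rw [ENNReal.ofReal_mul (hF0 u), ofReal_ellipticK_sqrt_one_sub_sq hu
      ((sq_lt_one_iff_abs_lt_one u).2 (abs_lt.2 hu1)),
      lintegral_const_mul _ (by fun_prop)]
  rw [e1, lintegral_lintegral_swap (by unfold Function.uncurry; fun_prop), ofReal_intervalIntegral
    (intervalIntegral.continuous_parametric_intervalIntegral_of_continuous' hFc _ _)
    (fun ψ => intervalIntegral.integral_nonneg hpi.le fun _ _ => hF0 _) (by positivity)]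
  refine setLIntegral_congr_fun measurableSet_Ioo fun ψ hψ => ?_
  have hc : 0 < Real.cos ψ := Real.cos_pos_of_mem_Ioo ⟨by linarith [hψ.1], hψ.2⟩
  rw [lintegral_mul_one_div_sqrt_sq_sub_sq F hc (Real.cos_le_one ψ),
    ofReal_intervalIntegral (f := fun φ => F (Real.cos ψ * Real.cos φ))
      (hFc.comp (Continuous.prodMk_right ψ)) (fun _ => hF0 _) hpi.le]

lemma integral_zero_pi_of_symmetric {Φ : ℝ → ℝ} (hΦ : Continuous Φ)
    (h : ∀ x, Φ (Real.pi - x) = Φ x) :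
    ∫ x in (0 : ℝ)..Real.pi, Φ x = 2 * ∫ x in (0 : ℝ)..Real.pi / 2, Φ x := by
  rw [← intervalIntegral.integral_add_adjacent_intervals (hΦ.intervalIntegrable 0 (Real.pi / 2))
    (hΦ.intervalIntegrable (Real.pi / 2) Real.pi),
    two_mul (∫ x in (0 : ℝ)..Real.pi / 2, Φ x), add_right_inj]
  have := intervalIntegral.integral_comp_sub_left (a := 0) (b := Real.pi / 2) Φ Real.pi
  simp only [h, sub_zero] at this
  rw [this]
  congr 1; ring

/-- Everything is nonnegative, so Tonelli's theorem yields a finite lower integral, hence both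
integrability and the value. The factor `1/2` comes from extending `ψ` from `(0, π/2)` to `(0, π)`
by the symmetry `φ ↦ π - φ`. -/
lemma integral_ellipticK_mul {F : ℝ → ℝ} (hF : Measurable F) (hF0 : ∀ u, 0 ≤ F u)
    (hFc : Continuous fun z : ℝ × ℝ => F (Real.cos z.1 * Real.cos z.2)) :
    IntervalIntegrable (fun u => F u * ellipticK √(1 - u ^ 2)) volume (-1) 1 ∧
    ∫ u in (-1 : ℝ)..1, F u * ellipticK √(1 - u ^ 2) =
      (∫ ψ in (0 : ℝ)..Real.pi, ∫ φ in (0 : ℝ)..Real.pi, F (Real.cos ψ * Real.cos φ)) / 2 := by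
  have hmeas : Measurable fun u => F u * ellipticK √(1 - u ^ 2) :=
    hF.mul (stronglyMeasurable_ellipticK.measurable.comp (by fun_prop))
  have hnn : ∀ u, 0 ≤ F u * ellipticK √(1 - u ^ 2) := fun u =>
    mul_nonneg (hF0 u) (ellipticK_nonneg _)
  have hl := lintegral_ellipticK_mul hF hF0 hFc
  constructor
  · rw [intervalIntegrable_iff_integrableOn_Ioo_of_le (by norm_num)]
    refine ⟨hmeas.aestronglyMeasurable, ?_⟩
    rw [hasFiniteIntegral_iff_ofReal (.of_forall hnn), hl]
    exact ENNReal.ofReal_lt_top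
  · rw [intervalIntegral.integral_of_le (by norm_num), integral_Ioc_eq_integral_Ioo,
      integral_eq_lintegral_of_nonneg_ae (.of_forall hnn) hmeas.aestronglyMeasurable, hl,
      ENNReal.toReal_ofReal, integral_zero_pi_of_symmetric
        (intervalIntegral.continuous_parametric_intervalIntegral_of_continuous' hFc _ _)]
    · ring
    · intro x
      have := intervalIntegral.integral_comp_sub_left (a := 0) (b := Real.pi)
        (fun φ => F (Real.cos x * Real.cos φ)) Real.pi
      rw [sub_self, sub_zero] at this
      rw [← this]
      simp only [Real.cos_pi_sub, mul_neg, neg_mul]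
    · exact intervalIntegral.integral_nonneg (by positivity) fun _ _ =>
        intervalIntegral.integral_nonneg (by positivity) fun _ _ => hF0 _

/-! ### Assembling the evaluation. -/

theorem mainTheorem4 :
    IntervalIntegrable
      (fun x : ℝ => ellipticK (2 * Real.sqrt (x * (1 - x))) /
        Real.sqrt (9 / 8 + (1 - 2 * x) / Real.sqrt 2))
      MeasureTheory.volume 0 1 ∧
    ∫ x in (0 : ℝ)..1, ellipticK (2 * Real.sqrt (x * (1 - x))) /
        Real.sqrt (9 / 8 + (1 - 2 * x) / Real.sqrt 2)
      = Real.Gamma (1 / 4) ^ 4 / (16 * Real.sqrt 2 * Real.pi) := by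
  have hpos : ∀ z : ℝ × ℝ, 0 < 9 / 8 + Real.cos z.1 * Real.cos z.2 / √2 := fun z => by
    have := (abs_le.1 (abs_cos_mul_cos_div_sqrt_two_le z.1 z.2)).1
    linarith [one_div_sqrt_two_add_lt]
  obtain ⟨hint, heq⟩ := integral_ellipticK_mul (F := fun u => 1 / √(9 / 8 + u / √2))
    (by fun_prop) (fun _ => by positivity) (continuous_one_div_sqrt (by fun_prop) hpos)
  have hfun : (fun x : ℝ => ellipticK (2 * √(x * (1 - x))) / √(9 / 8 + (1 - 2 * x) / √2)) =
      fun x => (fun u => 1 / √(9 / 8 + u / √2) * ellipticK √(1 - u ^ 2)) (1 - 2 * x) := by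
    funext x
    dsimp only
    rw [show 1 - (1 - 2 * x) ^ 2 = 2 ^ 2 * (x * (1 - x)) by ring,
      Real.sqrt_mul (sq_nonneg 2), Real.sqrt_sq zero_le_two]
    ring
  rw [hfun]
  constructor
  -- The substitution `u = 1 - 2x` reverses orientation, whence the final `symm`.
  · have h1 := (hint.comp_sub_left 1).comp_mul_left (c := 2)
    norm_num at h1
    simpa using h1.symm
  · rw [intervalIntegral.integral_comp_sub_mul
      (fun u => 1 / √(9 / 8 + u / √2) * ellipticK √(1 - u ^ 2)) two_ne_zero, mul_one, mul_zero,
      sub_zero,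
      show (1 - 2 : ℝ) = -1 by norm_num, heq, integral_ring_eq,
      integral_integral_eq_lemniscatePeriod_sq, sqrt_eight_mul_lemniscatePeriod_sq, smul_eq_mul]
    have := Real.pi_pos
    field_simp
    norm_num
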